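/- Consider the $K$-user SISO interference channel, $K\ge 1$, in which every transmitter has one conventional antenna and every receiver has one reconfigurable antenna with $M\ge 2$ modes. The coefficient from transmitter $i$ to receiver $k$ in mode $a$ of receiver $k$'s antenna is $h_{ki}(a)\in\mathbb{C}$. The $K^2M$ coefficients are drawn i.i.d. from a continuous (atomless) distribution and stay constant over the channel uses. A linear blind interference alignment scheme with staggered antenna switching consists of a number $m\ge1$ of channel uses, a switching pattern $p_k:\{1,\dots,m\}\to\{1,\dots,M\}$ for each receiver $k$, a number $d_i\ge 0$ of symbols for each user $i$, and beamforming vectors $u^{[i]}_1,\dots,u^{[i]}_{d_i}\in\mathbb{C}^m$, all chosen without knowledge of the channel coefficients (no CSIT). Let $H_{ki}=\mathrm{diag}\big(h_{ki}(p_k(1)),\dots,h_{ki}(p_k(m))\big)$. The scheme works for a given channel realization if, at every receiver $k$, the desired vectors $H_{kk}u^{[k]}_1,\dots,H_{kk}u^{[k]}_{d_k}$ are linearly independent and their span intersects the span of all interference vectors $H_{ki}u^{[i]}_s$ ($i\ne k$, $1\le s\le d_i$) only in $0$. A sum DoF $D$ is achievable almost surely if some scheme with $\frac1m\sum_{i=1}^K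 d_i=D$ works for almost every channel realization (the same scheme for all continuous distributions). Theorem. For every $K\ge1$ and every $M\ge2$, the sum DoF $\dfrac{2K}{K+2}$ is achievable almost surely by linear blind interference alignment with staggered antenna switching. -/

import Mathlib

open MeasureTheory

noncomputable section

namespace BIA

/-- Indices of the channel coefficients of the `K`-user SISO interference channel whose receivers
have antennas with `M` modes: `(k, i, a)` stands for receiver `k`, transmitter `i` and mode `a` of
the antenna of receiver `k`. -/
abbrev ChannelIndex (K M : ℕ) : Type := Fin K × Fin K × Fin M

/-- A realization of the channel: `h (k, i, a)` is the coefficient `h_{ki}(a)`. It does not depend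
on the channel use. -/
abbrev Channel (K M : ℕ) : Type := ChannelIndex K M → ℂ

/-- A linear blind scheme with antenna switching at the receivers. It is fixed without reference
to the channel realization (there is no channel state information at the transmitters). -/
structure Scheme (K M : ℕ) where
  /-- number of channel uses -/
  m : ℕ
  m_pos : 0 < m
  /-- `d i` is the number of symbols sent by transmitter `i` over the `m` channel uses -/
  d : Fin K → ℕ
  /-- `p k t` is the antenna mode selected by receiver `k` at channel use `t` -/
  p : Fin K → Fin m → Fin M
  /-- `u i s` is the beamforming vector of the `s`-th symbol of transmitter `i` -/
  u : (i : Fin K) → Fin (d i) → (Fin m → ℂ)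

namespace Scheme

variable {K M : ℕ}

/-- The `m × m` diagonal channel matrix `H_{ki}` from transmitter `i` to receiver `k`. -/
def channelMatrix (S : Scheme K M) (h : Channel K M) (k i : Fin K) :
    Matrix (Fin S.m) (Fin S.m) ℂ :=
  Matrix.diagonal fun t => h (k, i, S.p k t)

/-- The direction `H_{ki} u_s^{[i]}` along which receiver `k` sees the `s`-th symbol of
transmitter `i`. -/
def receivedVector (S : Scheme K M) (h : Channel K M) (k i : Fin K) (s : Fin (S.d i)) :
    Fin S.m → ℂ :=
  Matrix.mulVec (S.channelMatrix h k i) (S.u i s)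

/-- The space occupied at receiver `k` by the signal of transmitter `i`. -/
def signalSpace (S : Scheme K M) (h : Channel K M) (k i : Fin K) :
    Submodule ℂ (Fin S.m → ℂ) :=
  Submodule.span ℂ (Set.range (S.receivedVector h k i))

/-- The space occupied at receiver `k` by the interference, that is, by the signals of all
transmitters other than `k`. -/
def interferenceSpace (S : Scheme K M) (h : Channel K M) (k : Fin K) :
    Submodule ℂ (Fin S.m → ℂ) :=
  ⨆ i : {i : Fin K // i ≠ k}, S.signalSpace h k i

/-- Receiver `k` resolves all its desired symbols free of interference: the desired signal vectors
are linearly independent, and their span meets the interference space only in `0`. -/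
def DecodableAt (S : Scheme K M) (h : Channel K M) (k : Fin K) : Prop :=
  LinearIndependent ℂ (S.receivedVector h k k) ∧
    Disjoint (S.signalSpace h k k) (S.interferenceSpace h k)

/-- The number of symbols per channel use, summed over all users. -/
def sumDoF (S : Scheme K M) : ℝ :=
  (∑ i, (S.d i : ℝ)) / (S.m : ℝ)

end Scheme

/-- The sum DoF `D` is achievable almost surely by linear blind interference alignment with antenna
switching: one scheme with sum DoF `D`, chosen without knowledge of the channel, is such that, for
channel coefficients drawn i.i.d. from a continuous (atomless) law on `ℂ`, almost surely every
receiver resolves all its desired symbols. -/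
def AchievableAlmostSurely (K M : ℕ) (D : ℝ) : Prop :=
  ∃ S : Scheme K M, S.sumDoF = D ∧
    ∀ (μ : Measure ℂ) [IsProbabilityMeasure μ] [NullSingletonClass μ],
      ∀ᵐ h ∂(Measure.pi fun _ : ChannelIndex K M => μ), ∀ k : Fin K, S.DecodableAt h k

end BIA

end

namespace BIA

/-! Put `K = n + 1`. Every pair of users shares one beamforming vector: the indicator of a slot
private to the pair, extended by a common part on `n` further slots. Receiver `k` leaves mode `0`
only in the private slots of its own pairs. A pair without `k` is thus seen in one mode and its two
signals align, filling `n(n-1)/2` dimensions in total. A pair `{k, j}` is seen in both modes, so its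
two signals separate when a `2 × 2` channel determinant is nonzero; these pairs fill `2n`
dimensions. The sum `n(n+3)/2` is exactly the number of slots, and `n(n+1)` symbols are sent. The
functionals of `exists_zeroForcing` carry out the separation; `ae_pi_mul_sub_mul_ne_zero` supplies
the determinants. -/

/-- If a property holds for almost every value of one coordinate, whatever the other coordinates
are, then it holds almost everywhere for the product measure. -/
theorem ae_pi_of_forall_ae_update {ι E : Type*} [Fintype ι] [DecidableEq ι] [MeasurableSpace E]
    (μ : Measure E) [SigmaFinite μ] (i : ι) {P : (ι → E) → Prop}
    (hP : MeasurableSet {x | P x}) (h : ∀ x, ∀ᵐ y ∂μ, P (Function.update x i y)) :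
    ∀ᵐ x ∂(Measure.pi fun _ : ι => μ), P x := by
  have hm : Measurable ({x | P x}ᶜ.indicator (1 : (ι → E) → ENNReal)) :=
    measurable_one.indicator hP.compl
  rw [ae_iff, ← Set.compl_ofPred, ← lintegral_indicator_one hP.compl]
  rcases isEmpty_or_nonempty (ι → E) with hE | ⟨⟨x⟩⟩
  · simp [Measure.eq_zero_of_isEmpty]
  -- Tonelli, with coordinate `i` integrated first.
  rw [lintegral_eq_lmarginal_univ x, lmarginal_erase' _ hm (Finset.mem_univ i)]
  have h0 : (fun x => ∫⁻ y, {x | P x}ᶜ.indicator (1 : (ι → E) → ENNReal)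
      (Function.update x i y) ∂μ) = fun _ => 0 := by
    funext x
    refine (lintegral_congr_ae ?_).trans lintegral_zero
    filter_upwards [h x] with y hy
    simp [hy]
  rw [h0]
  simp [lmarginal]

theorem ae_pi_apply_ne_zero {ι : Type*} [Fintype ι] (μ : Measure ℂ) [IsProbabilityMeasure μ]
    [NullSingletonClass μ] (i : ι) : ∀ᵐ x ∂(Measure.pi fun _ : ι => μ), x i ≠ 0 := by
  classical
  refine ae_pi_of_forall_ae_update μ i ?_ fun x => ?_
  · exact (measurableSet_eq_fun (measurable_pi_apply i) measurable_const).compl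
  · simpa using Measure.ae_ne μ (0 : ℂ)

/-- A `2 × 2` determinant of distinct coordinates almost surely does not vanish. -/
theorem ae_pi_mul_sub_mul_ne_zero {ι : Type*} [Fintype ι] (μ : Measure ℂ) [IsProbabilityMeasure μ]
    [NullSingletonClass μ] {a b c d : ι} (hab : a ≠ b) (hbc : c ≠ b) (hbd : d ≠ b) :
    ∀ᵐ x ∂(Measure.pi fun _ : ι => μ), x b * x a - x d * x c ≠ 0 := by
  classical
  have h : ∀ᵐ x ∂(Measure.pi fun _ : ι => μ), x a ≠ 0 → x b * x a - x d * x c ≠ 0 := by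
    refine ae_pi_of_forall_ae_update μ b ?_ fun x => ?_
    · refine MeasurableSet.imp ?_ ?_
      · exact (measurableSet_eq_fun (measurable_pi_apply a) measurable_const).compl
      · exact (measurableSet_eq_fun (by fun_prop) measurable_const).compl
    -- The expression is affine in `x b`; its only root depends on the other coordinates alone.
    · filter_upwards [Measure.ae_ne μ (x d * x c / x a)] with y hy
      simp only [Function.update_self, Function.update_of_ne hab, Function.update_of_ne hbc,
        Function.update_of_ne hbd]
      intro ha h0
      exact hy (by rw [eq_div_iff ha]; exact sub_eq_zero.1 h0)
  filter_upwards [h, ae_pi_apply_ne_zero μ a] with x hx ha using hx ha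

namespace Scheme

variable {K M : ℕ}

theorem receivedVector_apply (S : Scheme K M) (h : Channel K M) (k i : Fin K) (s : Fin (S.d i))
    (t : Fin S.m) : S.receivedVector h k i s t = h (k, i, S.p k t) * S.u i s t := by
  simp [receivedVector, channelMatrix, Matrix.mulVec_diagonal]

/-- Zero-forcing: a receiver decodes as soon as it has linear functionals that annihilate the
interference and separate the desired symbols. -/
theorem decodableAt_of_dual (S : Scheme K M) (h : Channel K M) (k : Fin K)
    (l : Fin (S.d k) → Module.Dual ℂ (Fin S.m → ℂ)) (c : Fin (S.d k) → ℂ) (hc : ∀ s, c s ≠ 0)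
    (hdesired : ∀ s s', l s (S.receivedVector h k k s') = if s = s' then c s else 0)
    (hinterf : ∀ s i, i ≠ k → ∀ s', l s (S.receivedVector h k i s') = 0) :
    S.DecodableAt h k := by
  have hker : ∀ s, S.interferenceSpace h k ≤ LinearMap.ker (l s) := by
    intro s
    refine iSup_le fun i => Submodule.span_le.2 ?_
    rintro _ ⟨s', rfl⟩
    exact hinterf s i i.2 s'
  have key : ∀ g : Fin (S.d k) → ℂ,
      ∑ s, g s • S.receivedVector h k k s ∈ S.interferenceSpace h k → ∀ s, g s = 0 := by
    intro g hg s
    have h0 : l s (∑ s, g s • S.receivedVector h k k s) = 0 := hker s hg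
    simpa [map_sum, hdesired, hc s] using h0
  refine ⟨Fintype.linearIndependent_iff.2 fun g hg => key g (hg ▸ Submodule.zero_mem _), ?_⟩
  rw [Submodule.disjoint_def]
  intro x hx hx'
  obtain ⟨g, rfl⟩ := (Submodule.mem_span_range_iff_exists_fun ℂ).1 hx
  simp [key g hx']

end Scheme

/-! ### Pairs of users and their common parts -/

/-- The unordered pairs of distinct users. -/
abbrev Edge (n : ℕ) : Type := {e : Sym2 (Fin (n + 1)) // ¬ e.IsDiag}

/-- The edge joining user `k` to the `s`-th of the other users. -/
def edge {n : ℕ} (k : Fin (n + 1)) (s : Fin n) : Edge n :=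
  ⟨s(k, k.succAbove s), by simp⟩

theorem edge_injective {n : ℕ} (k : Fin (n + 1)) : Function.Injective (edge k) := by
  intro s s' hs
  have := congrArg Subtype.val hs
  simpa [edge] using this

/-- An edge at user `i` contains user `k` only if it joins `k` to a user, which is `i` itself
when `i ≠ k`. -/
theorem exists_edge_eq_of_mem {n : ℕ} {k i : Fin (n + 1)} {s : Fin n}
    (h : k ∈ (edge i s).1) (hi : i ≠ k) : ∃ s', edge k s' = edge i s ∧ k.succAbove s' = i := by
  obtain ⟨s', hs'⟩ := Fin.exists_succAbove_eq hi
  refine ⟨s', Subtype.ext ?_, hs'⟩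
  have hk : k = i.succAbove s := by
    rcases Sym2.mem_iff.1 h with h | h
    · exact absurd h.symm hi
    · exact h
  simp only [edge, hs', ← hk]
  exact Sym2.eq_swap

/-- The part of the beamforming vector of an edge on the `n` channel uses in which no receiver
switches: user `0` contributes zero, and the other users the standard basis vectors. -/
def commonPart {n : ℕ} (e : Edge n) : Fin n → ℂ := fun t => if t.succ ∈ e.1 then 1 else 0

/-- With `e_0 = 0`, these are the vectors `e_k + e_j`, `j ≠ k`. The coordinate of a user `j ≠ 0`
other than `k` isolates the pair `{k, j}`. If `k ≠ 0`, only the pair `{k, 0}` is then left, and the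
coordinate of `k` detects it. -/
theorem linearIndependent_commonPart {n : ℕ} (k : Fin (n + 1)) :
    LinearIndependent ℂ fun s => commonPart (edge k s) := by
  rw [Fintype.linearIndependent_iff]
  intro g hg
  have hcoord : ∀ t : Fin n, ∑ s, g s * (if t.succ ∈ (edge k s).1 then (1 : ℂ) else 0) = 0 := by
    intro t
    simpa [commonPart] using congrFun hg t
  have hne : ∀ s, k.succAbove s ≠ 0 → g s = 0 := by
    intro s hs
    obtain ⟨t, ht⟩ := Fin.exists_succ_eq.2 hs
    have hsum := hcoord t
    rw [Finset.sum_eq_single s] at hsum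
    · simpa [edge, ht] using hsum
    · intro s' _ hs'
      simp [edge, ht, Fin.succAbove_ne, hs'.symm]
    · simp
  intro s
  by_cases hs : k.succAbove s = 0
  · have hk : k ≠ 0 := fun h => Fin.succAbove_ne k s (hs.trans h.symm)
    obtain ⟨t, ht⟩ := Fin.exists_succ_eq.2 hk
    have hsum := hcoord t
    rw [Finset.sum_eq_single s] at hsum
    · simpa [edge, ht] using hsum
    · intro s' _ hs'
      rw [hne s' fun h => hs' (Fin.succAbove_right_injective (h.trans hs.symm)), zero_mul]
    · simp
  · exact hne s hs

theorem exists_commonPart_dual {n : ℕ} (k : Fin (n + 1)) :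
    ∃ φ : (Fin n → ℂ) →ₗ[ℂ] (Fin n → ℂ), ∀ s, φ (commonPart (edge k s)) = Pi.single s 1 := by
  obtain ⟨φ, hφ⟩ := LinearMap.exists_leftInverse_of_injective
    (Fintype.linearCombination ℂ fun s => commonPart (edge k s))
    (LinearMap.ker_eq_bot.2 (linearIndependent_commonPart k).fintypeLinearCombination_injective)
  refine ⟨φ, fun s => ?_⟩
  simpa using LinearMap.congr_fun hφ (Pi.single s 1)

/-! ### The pair scheme and its rate -/

/-- The channel uses: one for every pair of users, and `n` common ones. -/
abbrev Slot (n : ℕ) : Type := Edge n ⊕ Fin n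

theorem card_slot (n : ℕ) : Fintype.card (Slot n) = (n + 1).choose 2 + n := by
  rw [Fintype.card_sum, Sym2.card_subtype_not_diag, Fintype.card_fin, Fintype.card_fin]

/-- Receiver `k` selects mode `1` in the channel uses of the pairs containing `k`, and mode `0`
otherwise. -/
def slotMode {n : ℕ} (k : Fin (n + 1)) : Slot n → Fin 2
  | .inl e => if k ∈ e.1 then 1 else 0
  | .inr _ => 0

/-- The beamforming vector shared by the two users of an edge. -/
def slotVector {n : ℕ} (e : Edge n) : Slot n → ℂ
  | .inl e' => if e' = e then 1 else 0
  | .inr t => commonPart e t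

/-- The scheme for `n + 1 ≥ 2` users: any two users share one beamforming vector. -/
noncomputable def pairScheme (n : ℕ) (hn : 0 < n) {M : ℕ} (mode : Fin 2 → Fin M) : Scheme (n + 1) M where
  m := Fintype.card (Slot n)
  m_pos := by rw [card_slot]; omega
  d _ := n
  p k t := mode (slotMode k ((Fintype.equivFin (Slot n)).symm t))
  u i s t := slotVector (edge i s) ((Fintype.equivFin (Slot n)).symm t)

theorem pairScheme_receivedVector {n : ℕ} (hn : 0 < n) {M : ℕ} (mode : Fin 2 → Fin M)
    (h : Channel (n + 1) M) (k i : Fin (n + 1)) (s : Fin n) (x : Slot n) :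
    (pairScheme n hn mode).receivedVector h k i s (Fintype.equivFin (Slot n) x) =
      h (k, i, mode (slotMode k x)) * slotVector (edge i s) x := by
  refine (Scheme.receivedVector_apply (pairScheme n hn mode) h k i s _).trans ?_
  simp [pairScheme]

theorem pairScheme_sumDoF {n : ℕ} (hn : 0 < n) {M : ℕ} (mode : Fin 2 → Fin M) :
    (pairScheme n hn mode).sumDoF = 2 * ((n + 1 : ℕ) : ℝ) / (((n + 1 : ℕ) : ℝ) + 2) := by
  have hcard : ((Fintype.card (Slot n) : ℕ) : ℝ) = n * (n + 3) / 2 := by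
    rw [card_slot, Nat.cast_add, Nat.cast_choose_two]
    push_cast
    ring
  have hn' : (n : ℝ) ≠ 0 := by exact_mod_cast hn.ne'
  have h3 : (n : ℝ) + 3 ≠ 0 := by positivity
  have h12 : (n : ℝ) + 1 + 2 ≠ 0 := by positivity
  simp only [Scheme.sumDoF, pairScheme, hcard, Finset.sum_const, Finset.card_univ,
    Fintype.card_fin, nsmul_eq_mul]
  push_cast
  field_simp
  ring

/-! ### Zero-forcing at a receiver -/

/-- The projection of a received signal at receiver `k` onto the common channel uses, along the
beamforming vectors of the pairs that do not contain `k`. -/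
def cancelOthers {n : ℕ} (k : Fin (n + 1)) : (Slot n → ℂ) →ₗ[ℂ] (Fin n → ℂ) :=
  LinearMap.pi fun t => LinearMap.proj (.inr t) -
    ∑ e : Edge n with k ∉ e.1, commonPart e t • LinearMap.proj (.inl e)

theorem cancelOthers_apply {n : ℕ} (k : Fin (n + 1)) (z : Slot n → ℂ) (t : Fin n) :
    cancelOthers k z t =
      z (.inr t) - ∑ e : Edge n with k ∉ e.1, commonPart e t * z (.inl e) := by
  simp [cancelOthers, LinearMap.sum_apply]

theorem cancelOthers_apply_of_mem {n : ℕ} {k : Fin (n + 1)} {e : Edge n} (hk : k ∈ e.1)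
    (g : Fin 2 → ℂ) :
    cancelOthers k (fun x => g (slotMode k x) * slotVector e x) = g 0 • commonPart e := by
  funext t
  rw [cancelOthers_apply, Finset.sum_eq_zero]
  · simp [slotVector, slotMode]
  · intro e' he'
    have : e' ≠ e := fun h => (Finset.mem_filter.1 he').2 (h ▸ hk)
    simp [slotVector, this]

/-- Receiver `k` is in mode `0` on the whole support of such a vector, which is therefore only
rescaled; its private slot predicts its common part. -/
theorem cancelOthers_apply_of_notMem {n : ℕ} {k : Fin (n + 1)} {e : Edge n} (hk : k ∉ e.1)
    (g : Fin 2 → ℂ) :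
    cancelOthers k (fun x => g (slotMode k x) * slotVector e x) = 0 := by
  funext t
  rw [cancelOthers_apply, Finset.sum_eq_single e]
  · simp [slotVector, slotMode, hk, mul_comm]
  · intro e' _ h
    simp [slotVector, h]
  · simp [hk]

/-- The zero-forcing functionals of receiver `k`, for a channel with coefficient `g i a` from
transmitter `i` in mode `a`. -/
theorem exists_zeroForcing {n : ℕ} (k : Fin (n + 1)) (g : Fin (n + 1) → Fin 2 → ℂ) :
    ∃ l : Fin n → Module.Dual ℂ (Slot n → ℂ),
      (∀ s s', l s (fun x => g k (slotMode k x) * slotVector (edge k s') x) =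
        if s = s' then g (k.succAbove s) 0 * g k 1 - g (k.succAbove s) 1 * g k 0 else 0) ∧
      ∀ s i, i ≠ k → ∀ s', l s (fun x => g i (slotMode k x) * slotVector (edge i s') x) = 0 := by
  obtain ⟨φ, hφ⟩ := exists_commonPart_dual k
  -- The private slot carries the mode `1` gain of a pair and coordinate `s` of `φ` its mode `0`
  -- gain. The weights are chosen to annihilate the partner, so that user `k` is left with the
  -- determinant.
  let l : Fin n → Module.Dual ℂ (Slot n → ℂ) := fun s =>
    g (k.succAbove s) 0 • LinearMap.proj (.inl (edge k s)) -
      g (k.succAbove s) 1 • (LinearMap.proj s ∘ₗ φ ∘ₗ cancelOthers k)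
  have hmem : ∀ s : Fin n, k ∈ (edge k s).1 := fun s => Sym2.mem_mk_left _ _
  have hl : ∀ s z, l s z =
      g (k.succAbove s) 0 * z (.inl (edge k s)) - g (k.succAbove s) 1 * φ (cancelOthers k z) s :=
    fun s z => rfl
  have hshared : ∀ s i s', l s (fun x => g i (slotMode k x) * slotVector (edge k s') x) =
      if s = s' then g (k.succAbove s) 0 * g i 1 - g (k.succAbove s) 1 * g i 0 else 0 := by
    intro s i s'
    rw [hl, cancelOthers_apply_of_mem (hmem s'), map_smul, hφ]
    by_cases hs : s = s'
    · subst hs; simp [slotVector, slotMode, hmem]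
    · simp [slotVector, hs, (edge_injective k).eq_iff]
  refine ⟨l, fun s s' => hshared s k s', fun s i hi s' => ?_⟩
  by_cases hk : k ∈ (edge i s').1
  · obtain ⟨s'', he, hs''⟩ := exists_edge_eq_of_mem hk hi
    rw [← he, hshared]
    split_ifs with hs
    · rw [hs, hs'']; ring
    · rfl
  · have hne : edge k s ≠ edge i s' := fun he => hk (he ▸ hmem s)
    rw [hl, cancelOthers_apply_of_notMem hk]
    simp [slotVector, hne]

theorem pairScheme_decodableAt {n : ℕ} (hn : 0 < n) {M : ℕ} (mode : Fin 2 → Fin M)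
    (h : Channel (n + 1) M) (k : Fin (n + 1))
    (hdet : ∀ s, h (k, k.succAbove s, mode 0) * h (k, k, mode 1) -
      h (k, k.succAbove s, mode 1) * h (k, k, mode 0) ≠ 0) :
    (pairScheme n hn mode).DecodableAt h k := by
  obtain ⟨l, hdesired, hinterf⟩ := exists_zeroForcing k fun i a => h (k, i, mode a)
  let R : (Fin (Fintype.card (Slot n)) → ℂ) →ₗ[ℂ] (Slot n → ℂ) :=
    LinearMap.funLeft ℂ ℂ (Fintype.equivFin (Slot n))
  have hR : ∀ (i : Fin (n + 1)) (s : Fin n),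
      R ((pairScheme n hn mode).receivedVector h k i s) =
        fun x => h (k, i, mode (slotMode k x)) * slotVector (edge i s) x := fun i s =>
    funext fun x => pairScheme_receivedVector hn mode h k i s x
  exact Scheme.decodableAt_of_dual _ h k (fun s : Fin n => l s ∘ₗ R) _ hdet
    (fun s s' => (congrArg (l s) (hR k s')).trans (hdesired s s'))
    (fun s i hi s' => (congrArg (l s) (hR i s')).trans (hinterf s i hi s'))

theorem achievableAlmostSurely_of_two_le_users {n M : ℕ} (hn : 0 < n) (hM : 2 ≤ M) :
    AchievableAlmostSurely (n + 1) M
      (2 * ((n + 1 : ℕ) : ℝ) / (((n + 1 : ℕ) : ℝ) + 2)) := by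
  have hmode : Fin.castLE hM 0 ≠ Fin.castLE hM 1 := by simp
  refine ⟨pairScheme n hn (Fin.castLE hM), pairScheme_sumDoF hn _, fun μ _ _ => ?_⟩
  have hae : ∀ᵐ h ∂(Measure.pi fun _ : ChannelIndex (n + 1) M => μ),
      ∀ (k : Fin (n + 1)) (s : Fin n),
        h (k, k.succAbove s, Fin.castLE hM 0) * h (k, k, Fin.castLE hM 1) -
          h (k, k.succAbove s, Fin.castLE hM 1) * h (k, k, Fin.castLE hM 0) ≠ 0 := by
    rw [ae_all_iff]; intro k
    rw [ae_all_iff]; intro s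
    apply ae_pi_mul_sub_mul_ne_zero μ
    · simp [(Fin.succAbove_ne k s).symm]
    · simp [(Fin.succAbove_ne k s).symm]
    · simp
  filter_upwards [hae] with h hh k using pairScheme_decodableAt hn _ h k (hh k)

/-- The scheme for a single user, who sends two symbols over three channel uses. -/
def singleUserScheme {M : ℕ} (a : Fin M) : Scheme 1 M where
  m := 3
  m_pos := by norm_num
  d _ := 2
  p _ _ := a
  u _ s := Pi.single s.castSucc 1

theorem achievableAlmostSurely_single_user {M : ℕ} (a : Fin M) :
    AchievableAlmostSurely 1 M (2 * ((1 : ℕ) : ℝ) / (((1 : ℕ) : ℝ) + 2)) := by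
  refine ⟨singleUserScheme a, by norm_num [Scheme.sumDoF, singleUserScheme], fun μ _ _ => ?_⟩
  filter_upwards [ae_pi_apply_ne_zero μ ((0, 0, a) : ChannelIndex 1 M)] with h hh k
  obtain rfl := Subsingleton.elim k 0
  refine Scheme.decodableAt_of_dual _ h 0
    (fun s : Fin 2 => (LinearMap.proj s.castSucc : Module.Dual ℂ (Fin 3 → ℂ)))
    (fun _ => h (0, 0, a)) (fun _ => hh) (fun (s s' : Fin 2) => ?_)
    (fun s i hi => absurd (Subsingleton.elim i 0) hi)
  refine (Scheme.receivedVector_apply (singleUserScheme a) h 0 0 s' s.castSucc).trans ?_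
  by_cases hs : s = s'
  · simp [singleUserScheme, hs]
  · simp [singleUserScheme, hs]

end BIA

theorem theorem1 (K M : ℕ) (hK : 1 ≤ K) (hM : 2 ≤ M) :
    BIA.AchievableAlmostSurely K M (2 * (K : ℝ) / ((K : ℝ) + 2)) := by
  obtain ⟨n, rfl⟩ := Nat.exists_eq_add_of_le' hK
  -- For `n = 0` the pair scheme would have no channel uses.
  rcases Nat.eq_zero_or_pos n with rfl | hn
  · exact BIA.achievableAlmostSurely_single_user ⟨0, by omega⟩
  · exact BIA.achievableAlmostSurely_of_two_le_users hn hM
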